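/- Let $N,m\ge 1$ be integers, let $\Omega\subset\mathbb R^N$ be a bounded domain, let $0<q<1$, and let $a:\Omega\to[0,\infty)$ be bounded and measurable. Write $\|\cdot\|$ for the norm of $L^2(\Omega)$ and let $W_0^{m,2}(\Omega)$ be the closure in the $W^{m,2}(\Omega)$-norm of the space $C_0^m(\Omega)$ of $C^m$ functions with compact support in $\Omega$; put $|D^m v|^2=\sum_{|\alpha|=m}|D^\alpha v|^2$. For $|\alpha|=m$ let $a_\alpha(x,\xi)$, where $x\in\Omega$ and $\xi=(\xi_\gamma)_{|\gamma|\le m}$, be real Carathéodory functions (measurable in $x$, continuous in $\xi$) such that $|a_\alpha(x,\xi)|\le c\sum_{|\gamma|=m}|\xi_\gamma|$ with a constant $c$, and such that for some constant $C>0$ $$\int_\Omega\sum_{|\alpha|=m}a_\alpha(x,v,\dots,D^mv)\,D^\alpha v\,dx\ \ge\ C\int_\Omega|D^mv|^2\,dx\qquad\text{for all } v\in W_0^{m,2}(\Omega).$$ Given $u_0\in L^2(\Omega)$, consider the Cauchy–Dirichlet problem $$u_t+(-1)^m\sum_{|\alpha|=m}D^\alpha a_\alpha(x,u,\dots,D^mu)+a(x)|u|^{q-1}u=0\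 \text{ in }\Omega\times(0,\infty),\qquad D^\alpha u=0\ \text{ on }\partial\Omega\times(0,\infty)\ (|\alpha|\le m-1),\qquad u(\cdot,0)=u_0 .$$ A weak solution is a function $u\in C([0,\infty),L^2(\Omega))\cap L^2_{loc}([0,\infty),W_0^{m,2}(\Omega))$ with $u(\cdot,0)=u_0$ and $u_t\in L^2_{loc}([0,\infty),(W_0^{m,2}(\Omega))^*)$ such that for all $\zeta\in L^2_{loc}([0,\infty),W_0^{m,2}(\Omega))$ and all $T>0$ $$\int_0^T\Big[\langle u_t,\zeta\rangle+\int_\Omega\Big(\sum_{|\alpha|=m}a_\alpha(x,u,\dots,D^mu)D^\alpha\zeta+a(x)|u|^{q-1}u\,\zeta\Big)dx\Big]dt=0 .$$ For $h>0$ set $$\lambda_1(h)=\inf\Big\{\int_\Omega\big(|D^mv|^2+a(x)|v|^{1+q}\big)\,dx:\ v\in W_0^{m,2}(\Omega),\ \|v\|^2=h\Big\}$$ (with $1/0=+\infty$ below). If $\displaystyle\int_0^1\frac{dh}{\lambda_1(h)}<\infty$, then every weak solution $u$ vanishes in finite time: there is a least $T\ge 0$ such that $u(\cdot,t)=0$ a.e.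 in $\Omega$ for all $t\ge T$. Moreover $\int_0^{\|u_0\|^2}\frac{dh}{\lambda_1(h)}$ is finite and $$T\ \le\ \frac{1}{2\min\{1,C\}}\int_0^{\|u_0\|^2}\frac{dh}{\lambda_1(h)} ;$$ in particular, if $C\ge 1$, then $T\le\frac12\int_0^{\|u_0\|^2}\frac{dh}{\lambda_1(h)}$. -/

import Mathlib

open MeasureTheory Set
open scoped ENNReal ContDiff

noncomputable section

namespace Extinction

/-- Multi-indices `α = (α₁, …, α_N)` of length `|α| = α₁ + ⋯ + α_N ≤ m`
(every entry is then automatically at most `m`). -/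
abbrev MultiIndex (N m : ℕ) : Type :=
  {α : Fin N → Fin (m + 1) // ∑ i, (α i : ℕ) ≤ m}

/-- Multi-indices of length exactly `m`. -/
abbrev TopIndex (N m : ℕ) : Type :=
  {α : MultiIndex N m // ∑ i, (α.1 i : ℕ) = m}

/-- The multi-index `0`. -/
def zeroIndex (N m : ℕ) : MultiIndex N m := ⟨fun _ => 0, by simp⟩

/-- The classical partial derivative `∂f/∂xᵢ`. -/
def partialDeriv {N : ℕ} (i : Fin N) (f : EuclideanSpace ℝ (Fin N) → ℝ) :
    EuclideanSpace ℝ (Fin N) → ℝ :=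
  fun x => fderiv ℝ f x (EuclideanSpace.single i 1)

/-- The classical mixed derivative `D^α f = ∂₁^{α₁} ⋯ ∂_N^{α_N} f`. -/
def mixedDeriv {N : ℕ} (α : Fin N → ℕ) (f : EuclideanSpace ℝ (Fin N) → ℝ) :
    EuclideanSpace ℝ (Fin N) → ℝ :=
  (List.finRange N).foldr (fun i g => (partialDeriv i)^[α i] g) f

theorem partialDeriv_contDiff {N : ℕ} (i : Fin N) {k : ℕ} {f : EuclideanSpace ℝ (Fin N) → ℝ}
    (hf : ContDiff ℝ ((k + 1 : ℕ) : WithTop ℕ∞) f) :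
    ContDiff ℝ (k : WithTop ℕ∞) (partialDeriv i f) := by
  have h : ContDiff ℝ (k : WithTop ℕ∞) (fderiv ℝ f) :=
    hf.fderiv_right (by push_cast; exact le_rfl)
  exact h.clm_apply contDiff_const

theorem partialDeriv_linear {N : ℕ} (i : Fin N) {k : ℕ} {f g : EuclideanSpace ℝ (Fin N) → ℝ}
    (hf : ContDiff ℝ ((k + 1 : ℕ) : WithTop ℕ∞) f)
    (hg : ContDiff ℝ ((k + 1 : ℕ) : WithTop ℕ∞) g) (c : ℝ) :
    partialDeriv i (f + c • g) = partialDeriv i f + c • partialDeriv i g := by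
  funext x
  have hf' : DifferentiableAt ℝ f x := (hf.differentiable (by simp)) x
  have hg' : DifferentiableAt ℝ g x := (hg.differentiable (by simp)) x
  simp only [partialDeriv, Pi.add_apply, Pi.smul_apply]
  rw [fderiv_add hf' (hg'.const_smul c), fderiv_const_smul hg' c]
  simp

theorem partialDeriv_iterate_linear {N : ℕ} (i : Fin N) (j : ℕ) : ∀ {k : ℕ}
    {f g : EuclideanSpace ℝ (Fin N) → ℝ},
    ContDiff ℝ ((k + j : ℕ) : WithTop ℕ∞) f → ContDiff ℝ ((k + j : ℕ) : WithTop ℕ∞) g →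
    ∀ c : ℝ, ContDiff ℝ (k : WithTop ℕ∞) ((partialDeriv i)^[j] f) ∧
      (partialDeriv i)^[j] (f + c • g) =
        (partialDeriv i)^[j] f + c • (partialDeriv i)^[j] g := by
  induction j with
  | zero => intro k f g hf hg c; exact ⟨hf, rfl⟩
  | succ j ih =>
    intro k f g hf hg c
    simp only [Function.iterate_succ, Function.comp_apply]
    rw [partialDeriv_linear i (k := k + j) hf hg c]
    exact ih (partialDeriv_contDiff i (k := k + j) hf) (partialDeriv_contDiff i (k := k + j) hg) c

theorem foldr_linear {N : ℕ} (α : Fin N → ℕ) (l : List (Fin N)) : ∀ {k : ℕ}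
    {f g : EuclideanSpace ℝ (Fin N) → ℝ},
    ContDiff ℝ ((k + (l.map α).sum : ℕ) : WithTop ℕ∞) f →
    ContDiff ℝ ((k + (l.map α).sum : ℕ) : WithTop ℕ∞) g →
    ∀ c : ℝ, ContDiff ℝ (k : WithTop ℕ∞) (l.foldr (fun i g => (partialDeriv i)^[α i] g) f) ∧
      l.foldr (fun i g => (partialDeriv i)^[α i] g) (f + c • g) =
        l.foldr (fun i g => (partialDeriv i)^[α i] g) f +
          c • l.foldr (fun i g => (partialDeriv i)^[α i] g) g := by
  induction l with
  | nil => intro k f g hf hg c; exact ⟨by simpa using hf, rfl⟩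
  | cons i l ih =>
    intro k f g hf hg c
    simp only [List.map_cons, List.sum_cons, ← add_assoc] at hf hg
    simp only [List.foldr_cons]
    obtain ⟨h1, h2⟩ := ih (k := k + α i) hf hg c
    obtain ⟨h3, -⟩ := ih (k := k + α i) hg hf c
    rw [h2]
    exact partialDeriv_iterate_linear i (α i) h1 h3 c

theorem mixedDeriv_linear {N m : ℕ} (α : MultiIndex N m)
    {f g : EuclideanSpace ℝ (Fin N) → ℝ} (hf : ContDiff ℝ (m : WithTop ℕ∞) f)
    (hg : ContDiff ℝ (m : WithTop ℕ∞) g) (c : ℝ) :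
    mixedDeriv (fun i => (α.1 i : ℕ)) (f + c • g) =
      mixedDeriv (fun i => (α.1 i : ℕ)) f + c • mixedDeriv (fun i => (α.1 i : ℕ)) g := by
  have hs : ((List.finRange N).map (fun i => (α.1 i : ℕ))).sum ≤ m := by
    have h := α.2
    rwa [← List.sum_ofFn, List.ofFn_eq_map] at h
  have hle : ((0 + ((List.finRange N).map (fun i => (α.1 i : ℕ))).sum : ℕ) : WithTop ℕ∞) ≤
      (m : WithTop ℕ∞) := by
    rw [zero_add]; exact_mod_cast hs
  exact (foldr_linear (fun i => (α.1 i : ℕ)) (List.finRange N) (k := 0)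
    (hf.of_le hle) (hg.of_le hle) c).2

theorem mixedDeriv_zero {N m : ℕ} (α : MultiIndex N m) :
    mixedDeriv (fun i => (α.1 i : ℕ)) (0 : EuclideanSpace ℝ (Fin N) → ℝ) = 0 := by
  have h := mixedDeriv_linear (N := N) α (f := 0) (g := 0) contDiff_const contDiff_const 1
  simpa using h

/-- The real space `L²(Ω)`. -/
abbrev L2 {N : ℕ} (Ω : Set (EuclideanSpace ℝ (Fin N))) : Type :=
  Lp ℝ 2 (volume.restrict Ω)

/-- Families `(v_α)_{|α| ≤ m}` in `L²(Ω)` with the norm `(∑_{|α| ≤ m} ‖v_α‖²)^{1/2}`.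
The space `W^{m,2}(Ω)` sits in it isometrically through `v ↦ (D^α v)_{|α| ≤ m}`. -/
abbrev Jet {N : ℕ} (m : ℕ) (Ω : Set (EuclideanSpace ℝ (Fin N))) : Type :=
  PiLp 2 (fun _ : MultiIndex N m => L2 Ω)

/-- `C₀^m(Ω)`: functions of class `C^m` with compact support contained in `Ω`. -/
def IsTest {N : ℕ} (m : ℕ) (Ω : Set (EuclideanSpace ℝ (Fin N)))
    (φ : EuclideanSpace ℝ (Fin N) → ℝ) : Prop :=
  ContDiff ℝ (m : WithTop ℕ∞) φ ∧ HasCompactSupport φ ∧ tsupport φ ⊆ Ω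

theorem IsTest.add_smul {N m : ℕ} {Ω : Set (EuclideanSpace ℝ (Fin N))}
    {φ ψ : EuclideanSpace ℝ (Fin N) → ℝ} (hφ : IsTest m Ω φ) (hψ : IsTest m Ω ψ) (c : ℝ) :
    IsTest m Ω (φ + c • ψ) := by
  have hc : tsupport (c • ψ) ⊆ tsupport ψ :=
    closure_mono (Function.support_const_smul_subset c ψ)
  refine ⟨hφ.1.add (hψ.1.const_smul c), hφ.2.1.add ?_, ?_⟩
  · exact hψ.2.1.of_isClosed_subset (isClosed_tsupport _) hc
  · exact (tsupport_add φ (c • ψ)).trans (union_subset hφ.2.2 (hc.trans hψ.2.2))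

/-- The image of `C₀^m(Ω)` under `φ ↦ (D^α φ)_{|α| ≤ m}`. -/
def testJets {N : ℕ} (m : ℕ) (Ω : Set (EuclideanSpace ℝ (Fin N))) : Submodule ℝ (Jet m Ω) where
  carrier := {V | ∃ φ, IsTest m Ω φ ∧ ∀ α : MultiIndex N m,
    (V α : EuclideanSpace ℝ (Fin N) → ℝ) =ᵐ[volume.restrict Ω]
      mixedDeriv (fun i => (α.1 i : ℕ)) φ}
  add_mem' := by
    rintro V W ⟨φ, hφ, hV⟩ ⟨ψ, hψ, hW⟩
    refine ⟨φ + (1 : ℝ) • ψ, hφ.add_smul hψ 1, fun α => ?_⟩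
    rw [mixedDeriv_linear α hφ.1 hψ.1 1]
    filter_upwards [Lp.coeFn_add (V α) (W α), hV α, hW α] with x h1 h2 h3
    rw [PiLp.add_apply, h1]
    simp [h2, h3]
  zero_mem' := by
    refine ⟨0, ⟨contDiff_const, HasCompactSupport.zero, by simp [tsupport]⟩, fun α => ?_⟩
    rw [mixedDeriv_zero α]
    exact Lp.coeFn_zero ℝ 2 (volume.restrict Ω)
  smul_mem' := by
    rintro c V ⟨φ, hφ, hV⟩
    have h0 : IsTest m Ω (0 : EuclideanSpace ℝ (Fin N) → ℝ) :=
      ⟨contDiff_const, HasCompactSupport.zero, by simp [tsupport]⟩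
    refine ⟨0 + c • φ, h0.add_smul hφ c, fun α => ?_⟩
    rw [mixedDeriv_linear α h0.1 hφ.1 c, mixedDeriv_zero α]
    filter_upwards [Lp.coeFn_smul c (V α), hV α] with x h1 h2
    rw [PiLp.smul_apply, h1]
    simp [h2]

/-- `W₀^{m,2}(Ω)`: the closure of `C₀^m(Ω)` in the `W^{m,2}(Ω)` norm. An element is stored with
its derivatives, as the family `(D^α v)_{|α| ≤ m}`. -/
def W0 {N : ℕ} (m : ℕ) (Ω : Set (EuclideanSpace ℝ (Fin N))) : Submodule ℝ (Jet m Ω) :=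
  (testJets m Ω).topologicalClosure

/-- The (weak) derivative `D^α v` of `v ∈ W₀^{m,2}(Ω)`, `|α| ≤ m`. -/
def W0.D {N m : ℕ} {Ω : Set (EuclideanSpace ℝ (Fin N))} (v : W0 m Ω) (α : MultiIndex N m) :
    L2 Ω := (v : Jet m Ω) α

/-- The function `v` itself, as an element of `L²(Ω)`. -/
def W0.fn {N m : ℕ} {Ω : Set (EuclideanSpace ℝ (Fin N))} (v : W0 m Ω) : L2 Ω :=
  W0.D v (zeroIndex N m)

/-- The values `(v(x), D v(x), …, D^m v(x)) ∈ ℝ^{M(m)}`. -/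
def W0.jetAt {N m : ℕ} {Ω : Set (EuclideanSpace ℝ (Fin N))} (v : W0 m Ω)
    (x : EuclideanSpace ℝ (Fin N)) : MultiIndex N m → ℝ := fun α => W0.D v α x

/-- `|D^m v(x)|² = ∑_{|α| = m} |D^α v(x)|²`. -/
def W0.topSq {N m : ℕ} {Ω : Set (EuclideanSpace ℝ (Fin N))} (v : W0 m Ω)
    (x : EuclideanSpace ℝ (Fin N)) : ℝ := ∑ α : TopIndex N m, |W0.D v α.1 x| ^ 2

/-- `λ₁(h)`, the infimum of `∫_Ω (|D^m v|² + a |v|^{1+q}) dx` over `v ∈ W₀^{m,2}(Ω)` with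
`‖v‖²_{L²(Ω)} = h`, as an element of `[0, ∞]`. -/
def lambda1 {N : ℕ} (m : ℕ) (Ω : Set (EuclideanSpace ℝ (Fin N)))
    (a : EuclideanSpace ℝ (Fin N) → ℝ) (q h : ℝ) : ℝ≥0∞ :=
  ⨅ (v : W0 m Ω) (_ : ‖W0.fn v‖ ^ 2 = h),
    ∫⁻ x in Ω, ENNReal.ofReal (W0.topSq v x + a x * |W0.fn v x| ^ (1 + q))

/-- The coefficients `a_α(x, ξ)`, `|α| = m`, `ξ ∈ ℝ^{M(m)}`, of the operator
`L(u) = (-1)^m ∑_{|α| = m} D^α a_α(x, u, Du, …, D^m u)`. -/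
abbrev Coeff (N m : ℕ) : Type :=
  TopIndex N m → EuclideanSpace ℝ (Fin N) → (MultiIndex N m → ℝ) → ℝ

/-- Carathéodory functions on `Ω`: measurable in `x`, continuous in `ξ`. -/
def IsCaratheodory {N m : ℕ} (Ω : Set (EuclideanSpace ℝ (Fin N))) (A : Coeff N m) : Prop :=
  ∀ α, (∀ ξ, AEMeasurable (fun x => A α x ξ) (volume.restrict Ω)) ∧
    ∀ x ∈ Ω, Continuous (A α x)

/-- The growth condition `|a_α(x, ξ)| ≤ c ∑_{|γ| = m} |ξ_γ|`. -/
def HasSublinearGrowth {N m : ℕ} (Ω : Set (EuclideanSpace ℝ (Fin N))) (A : Coeff N m) : Prop :=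
  ∃ c : ℝ, ∀ α, ∀ x ∈ Ω, ∀ ξ, |A α x ξ| ≤ c * ∑ γ : TopIndex N m, |ξ γ.1|

/-- `∑_{|α| = m} a_α(x, v, …, D^m v) D^α w` at the point `x`. -/
def fluxDensity {N m : ℕ} {Ω : Set (EuclideanSpace ℝ (Fin N))} (A : Coeff N m) (v w : W0 m Ω)
    (x : EuclideanSpace ℝ (Fin N)) : ℝ :=
  ∑ α : TopIndex N m, A α x (W0.jetAt v x) * W0.D w α.1 x

/-- Coercivity with constant `C`: `(L(v), v) ≥ C ∫_Ω |D^m v|² dx` for all `v ∈ W₀^{m,2}(Ω)`. -/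
def IsCoercive {N m : ℕ} (Ω : Set (EuclideanSpace ℝ (Fin N))) (A : Coeff N m) (C : ℝ) : Prop :=
  ∀ v : W0 m Ω, C * (∫ x in Ω, W0.topSq v x) ≤ ∫ x in Ω, fluxDensity A v v x

/-- Membership in `L²_loc([0, ∞), X)`. -/
def MemL2Loc {X : Type*} [NormedAddCommGroup X] (z : ℝ → X) : Prop :=
  ∀ T : ℝ, 0 < T → MemLp z 2 (volume.restrict (Ioc 0 T))

/-- `G` is the derivative `u_t` of `u` in the sense of distributions on `(0, ∞)` with values in
the dual of `W₀^{m,2}(Ω)`, where `L²(Ω)` is embedded in that dual by the `L²` inner product. -/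
def IsTimeDeriv {N m : ℕ} {Ω : Set (EuclideanSpace ℝ (Fin N))} (u : ℝ → L2 Ω)
    (G : ℝ → StrongDual ℝ (W0 m Ω)) : Prop :=
  ∀ (w : W0 m Ω) (φ : ℝ → ℝ), ContDiff ℝ ∞ φ → HasCompactSupport φ → tsupport φ ⊆ Ioi 0 →
    (∫ t in Ioi (0 : ℝ), deriv φ t * inner ℝ (u t) (W0.fn w)) =
      -∫ t in Ioi (0 : ℝ), φ t * G t w

/-- Weak solutions on `[0, ∞)` of `u_t + L(u) + a(x)|u|^{q-1}u = 0` with homogeneous Dirichlet data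
and `u(0) = u₀`: `u ∈ C([0, ∞), L²(Ω)) ∩ L²_loc([0, ∞), W₀^{m,2}(Ω))` (`U` is `u`, seen as a
function of time with values in `W₀^{m,2}(Ω)`), `u_t ∈ L²_loc([0, ∞), W₀^{m,2}(Ω)*)`, and the
integral identity holds for all `ζ ∈ L²_loc([0, ∞), W₀^{m,2}(Ω))` and all `T > 0`. -/
def IsWeakSolution {N m : ℕ} {Ω : Set (EuclideanSpace ℝ (Fin N))} (A : Coeff N m)
    (a : EuclideanSpace ℝ (Fin N) → ℝ) (q : ℝ) (u₀ : L2 Ω) (u : ℝ → L2 Ω) : Prop :=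
  ContinuousOn u (Ici 0) ∧ u 0 = u₀ ∧
  ∃ (U : ℝ → W0 m Ω) (G : ℝ → StrongDual ℝ (W0 m Ω)),
    MemL2Loc U ∧ (∀ᵐ t ∂(volume.restrict (Ioi (0 : ℝ))), W0.fn (U t) = u t) ∧
    MemL2Loc G ∧ IsTimeDeriv u G ∧
    ∀ z : ℝ → W0 m Ω, MemL2Loc z → ∀ T : ℝ, 0 < T →
      IntegrableOn (fun t => G t (z t) + ∫ x in Ω, (fluxDensity A (U t) (z t) x +
        a x * (|W0.fn (U t) x| ^ (q - 1) * W0.fn (U t) x) * W0.fn (z t) x)) (Ioc 0 T) ∧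
      ∫ t in Ioc 0 T, (G t (z t) + ∫ x in Ω, (fluxDensity A (U t) (z t) x +
        a x * (|W0.fn (U t) x| ^ (q - 1) * W0.fn (U t) x) * W0.fn (z t) x)) = 0

/-- `T` is the extinction time of `u`: the least `T ≥ 0` such that `u(·, t) = 0` a.e. in `Ω` for
all `t ≥ T`. -/
def IsExtinctionTime {N : ℕ} {Ω : Set (EuclideanSpace ℝ (Fin N))} (u : ℝ → L2 Ω) (T : ℝ) : Prop :=
  IsLeast {s : ℝ | 0 ≤ s ∧ ∀ t, s ≤ t → u t = 0} T

end Extinction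

end

/-!
Testing the equation with the solution itself shows that `y = ‖u‖²` satisfies
`y' ≤ -2 min{1, C} λ₁(y)` in integrated form. This needs only the inequality
`‖u(t)‖² - ‖u(s)‖² ≤ 2 ∫ₛᵗ ⟨u_t, u⟩`, which follows from
`‖u(t + h)‖² - ‖u(t)‖² ≤ 2 ⟨u(t + h) - u(t), u(t + h)⟩` on integrating in `t`, dividing by `h` and
letting `h → 0`, since translations act continuously on `L²`. Scaling `v ↦ σ v` with `σ ≤ 1` shows
that `λ₁` is nondecreasing, so the time `y` needs to descend from `h + δ` to `h` is at most
`δ / (2 min{1, C} λ₁(h))`, and such steps add up to at most a multiple of `∫ dh / λ₁(h)`.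
-/

namespace Extinction

open Filter Topology
open scoped Pointwise

theorem hasDerivAt_integral_comp_add {E : Type*} [NormedAddCommGroup E]
    [NormedSpace ℝ E] [CompleteSpace E] {f : ℝ → E} (hf : Continuous f) (a b x : ℝ) :
    HasDerivAt (fun x => ∫ t in a..b, f (t + x)) (f (b + x) - f (a + x)) x := by
  have hprim : ∀ x, ∫ t in a..b, f (t + x) = (∫ t in 0..b + x, f t) - ∫ t in 0..a + x, f t := by
    intro x
    rw [intervalIntegral.integral_comp_add_right, intervalIntegral.integral_interval_sub_left
      (hf.intervalIntegrable _ _) (hf.intervalIntegrable _ _)]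
  simp only [hprim]
  exact ((hf.integral_hasStrictDerivAt 0 (b + x)).hasDerivAt.comp_const_add b x).sub
    ((hf.integral_hasStrictDerivAt 0 (a + x)).hasDerivAt.comp_const_add a x)

theorem hasDerivAt_integral_comp_sub {ψ : ℝ → ℝ} (hψ : Continuous ψ) (h x : ℝ) :
    HasDerivAt (fun x => ∫ r in 0..h, ψ (x - r)) (ψ x - ψ (x - h)) x := by
  have hneg : ∀ x, ∫ r in 0..h, ψ (x - r) = ∫ r in -h..0, ψ (r + x) := fun x => by
    simpa only [neg_add_eq_sub, neg_zero] using
      intervalIntegral.integral_comp_neg (a := 0) (b := h) fun r => ψ (r + x)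
  simpa only [hneg, zero_add, neg_add_eq_sub] using hasDerivAt_integral_comp_add hψ (-h) 0 x

section WeakDerivative

variable {E : Type*} [NormedAddCommGroup E] [NormedSpace ℝ E]

/-- The distributional derivative of `p` on `S` is `g`; only meaningful for open `S` and locally
integrable `p` and `g`. -/
def IsWeakDerivOn (p g : ℝ → E) (S : Set ℝ) : Prop :=
  ∀ φ : ℝ → ℝ, ContDiff ℝ ∞ φ → HasCompactSupport φ → tsupport φ ⊆ S →
    ∫ t in S, deriv φ t • p t = -∫ t in S, φ t • g t

theorem integral_smul_congr {α : Type*} [MeasurableSpace α] {μ : Measure α} {f : α → ℝ}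
    {F₁ F₂ : α → E} (h : EqOn F₁ F₂ (Function.support f)) :
    ∫ x, f x • F₁ x ∂μ = ∫ x, f x • F₂ x ∂μ := by
  refine integral_congr_ae (Eventually.of_forall fun x => ?_)
  by_cases hx : f x = 0
  · simp only [hx, zero_smul]
  · exact congrArg (f x • ·) (h hx)

theorem setIntegral_smul_eq_integral_smul_indicator {f : ℝ → ℝ} {K S : Set ℝ}
    (hf : Function.support f ⊆ K) (hKS : K ⊆ S) (F : ℝ → E) :
    ∫ x in S, f x • F x = ∫ x, f x • K.indicator F x := by
  rw [setIntegral_eq_integral_of_forall_compl_eq_zero fun x hx => by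
    rw [Function.notMem_support.1 fun hfx => hx (hKS (hf hfx)), zero_smul]]
  exact integral_smul_congr fun x hx => (indicator_of_mem (hf hx) F).symm

theorem contDiff_integral_comp_sub {ψ : ℝ → ℝ} (hψ : ContDiff ℝ ∞ ψ) (h : ℝ) :
    ContDiff ℝ ∞ fun x => ∫ r in 0..h, ψ (x - r) := by
  have hderiv := hasDerivAt_integral_comp_sub hψ.continuous h
  rw [contDiff_infty_iff_deriv, funext fun x => (hderiv x).deriv]
  exact ⟨fun x => (hderiv x).differentiableAt,
    hψ.sub (hψ.comp (contDiff_id.sub contDiff_const))⟩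

theorem integral_comp_sub_eq_zero {ψ : ℝ → ℝ} {h : ℝ} (hh : 0 ≤ h) {x : ℝ}
    (hx : x ∉ tsupport ψ + Icc 0 h) : ∫ r in 0..h, ψ (x - r) = 0 := by
  refine intervalIntegral.integral_zero_ae (Eventually.of_forall fun r hr => ?_)
  rw [uIoc_of_le hh] at hr
  by_contra hne
  exact hx ⟨x - r, subset_tsupport ψ hne, r, Ioc_subset_Icc_self hr, sub_add_cancel x r⟩

theorem integral_smul_shift_sub {ψ : ℝ → ℝ} (hψ : Continuous ψ) (hψc : HasCompactSupport ψ)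
    {P : ℝ → E} (hP : Integrable P) (h : ℝ) :
    ∫ x, (ψ x - ψ (x - h)) • P x = -∫ y, ψ y • (P (y + h) - P y) := by
  obtain ⟨M, hM⟩ := hψc.exists_bound_of_continuous hψ
  have hint : ∀ {f : ℝ → ℝ} {F : ℝ → E}, Continuous f → (∀ x, ‖f x‖ ≤ M) → Integrable F →
      Integrable fun x => f x • F x := fun hf hfM hF =>
    hF.bdd_smul M hf.aestronglyMeasurable (Eventually.of_forall hfM)
  have htranslate : ∫ x, ψ (x - h) • P x = ∫ y, ψ y • P (y + h) := by
    simpa using (integral_add_right_eq_self (fun x => ψ (x - h) • P x) h).symm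
  simp only [sub_smul, smul_sub]
  rw [integral_sub (hint hψ hM hP) (hint (by fun_prop) (fun x => hM _) hP), htranslate,
    integral_sub (hint hψ hM (hP.comp_add_right h)) (hint hψ hM hP), neg_sub]

theorem continuousOn_primitive_Ioi {c s : ℝ} {g : ℝ → E}
    (hg : LocallyIntegrableOn g (Ioi c)) (hs : c < s) :
    ContinuousOn (fun x => ∫ r in s..x, g r) (Ioi c) := by
  intro x hx
  obtain ⟨a, hca, ha⟩ := exists_between (lt_min hs hx)
  obtain ⟨b, hb⟩ := exists_gt (max s x)
  rw [lt_min_iff] at ha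
  rw [max_lt_iff] at hb
  have hab : a ≤ b := (ha.1.trans hb.1).le
  have hint : IntervalIntegrable g volume a b :=
    (intervalIntegrable_iff_integrableOn_Icc_of_le hab).2
      (hg.integrableOn_compact_subset (fun r hr => hca.trans_le hr.1) isCompact_Icc)
  have hprim : ContinuousOn (fun x => ∫ r in s..x, g r) (uIcc a b) :=
    intervalIntegral.continuousOn_primitive_interval' hint (uIcc_of_le hab ▸ ⟨ha.1.le, hb.1.le⟩)
  exact (hprim.continuousAt (uIcc_of_le hab ▸ Icc_mem_nhds ha.2 hb.2)).continuousWithinAt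

variable [CompleteSpace E]

theorem integral_average_smul {ψ : ℝ → ℝ} (hψ : Continuous ψ) (hψc : HasCompactSupport ψ)
    {g : ℝ → E} (hg : Integrable g) {h : ℝ} (hh : 0 ≤ h) :
    ∫ x, (∫ r in 0..h, ψ (x - r)) • g x = ∫ y, ψ y • ∫ r in 0..h, g (y + r) := by
  simp only [intervalIntegral.integral_of_le hh]
  obtain ⟨M, hM⟩ := hψc.exists_bound_of_continuous hψ
  set ν : Measure ℝ := volume.restrict (Ioc 0 h)
  have hshift : Integrable (fun z : ℝ × ℝ => g (z.1 + z.2)) (volume.prod ν) :=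
    (measurePreserving_add_prod volume ν).integrable_comp_of_integrable (hg.comp_fst ν)
  have hleft : Integrable (Function.uncurry fun x r => ψ (x - r) • g x) (volume.prod ν) :=
    (hg.comp_fst ν).bdd_smul M (by fun_prop) (Eventually.of_forall fun z => hM _)
  have hright : Integrable (Function.uncurry fun y r => ψ y • g (y + r)) (volume.prod ν) :=
    hshift.bdd_smul M (by fun_prop) (Eventually.of_forall fun z => hM _)
  calc ∫ x, (∫ r, ψ (x - r) ∂ν) • g x = ∫ x, ∫ r, ψ (x - r) • g x ∂ν := by
        simp only [integral_smul_const]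
    _ = ∫ r, (∫ x, ψ (x - r) • g x) ∂ν := integral_integral_swap hleft
    _ = ∫ r, (∫ y, ψ y • g (y + r)) ∂ν := by
        refine integral_congr_ae (Eventually.of_forall fun r => ?_)
        simpa using (integral_add_right_eq_self (fun x => ψ (x - r) • g x) r).symm
    _ = ∫ y, ∫ r, ψ y • g (y + r) ∂ν := (integral_integral_swap hright).symm
    _ = ∫ y, ψ y • ∫ r, g (y + r) ∂ν := by simp only [integral_smul]

theorem eqOn_of_integral_smul_eq {U : Set ℝ} (hU : IsOpen U) {f₁ f₂ : ℝ → E}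
    (h₁ : ContinuousOn f₁ U) (h₂ : ContinuousOn f₂ U)
    (h : ∀ ψ : ℝ → ℝ, ContDiff ℝ ∞ ψ → HasCompactSupport ψ → tsupport ψ ⊆ U →
      ∫ y, ψ y • f₁ y = ∫ y, ψ y • f₂ y) : EqOn f₁ f₂ U := by
  have hint : ∀ {f : ℝ → E}, ContinuousOn f U → ∀ {ψ : ℝ → ℝ}, ContDiff ℝ ∞ ψ →
      HasCompactSupport ψ → tsupport ψ ⊆ U → Integrable fun y => ψ y • f y := by
    intro f hf ψ hψ hψc hψU
    refine Continuous.integrable_of_hasCompactSupport ?_ hψc.smul_right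
    refine continuous_of_tsupport fun x hx => hψ.continuous.continuousAt.smul
      (hf.continuousAt (hU.mem_nhds (hψU (tsupport_smul_subset_left ψ f hx))))
  have hzero := hU.ae_eq_zero_of_integral_contDiff_smul_eq_zero
    ((h₁.sub h₂).locallyIntegrableOn hU.measurableSet) fun ψ hψ hψc hψU => by
      simp only [Pi.sub_apply, smul_sub]
      rw [integral_sub (hint h₁ hψ hψc hψU) (hint h₂ hψ hψc hψU), h ψ hψ hψc hψU, sub_self]
  have hsub := Measure.eqOn_open_of_ae_eq ((ae_restrict_iff' hU.measurableSet).2 hzero) hU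
    (h₁.sub h₂) continuousOn_const
  exact fun y hy => sub_eq_zero.1 (hsub hy)

variable {c : ℝ} {p g : ℝ → E}

-- The test function is the moving average `φ(x) = ∫₀ʰ ψ(x - r) dr`, with `φ'(x) = ψ(x) - ψ(x - h)`.
theorem IsWeakDerivOn.integral_smul_increment_eq (hp : ContinuousOn p (Ioi c))
    (hg : LocallyIntegrableOn g (Ioi c)) (hpg : IsWeakDerivOn p g (Ioi c))
    {ψ : ℝ → ℝ} (hψ : ContDiff ℝ ∞ ψ) (hψc : HasCompactSupport ψ) (hψs : tsupport ψ ⊆ Ioi c)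
    {h : ℝ} (hh : 0 ≤ h) :
    ∫ y, ψ y • (p (y + h) - p y) = ∫ y, ψ y • ∫ r in 0..h, g (y + r) := by
  set K : Set ℝ := tsupport ψ + Icc 0 h
  have hKc : IsCompact K := hψc.isCompact.add isCompact_Icc
  have hKs : K ⊆ Ioi c := by
    rintro _ ⟨y, hy, r, hr, rfl⟩
    exact (hψs hy).trans_le (le_add_of_nonneg_right hr.1)
  have hPint : Integrable (K.indicator p) := (integrable_indicator_iff hKc.measurableSet).2
    ((hp.mono hKs).integrableOn_compact hKc)
  have hQint : Integrable (K.indicator g) := (integrable_indicator_iff hKc.measurableSet).2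
    (hg.integrableOn_compact_subset hKs hKc)
  set φ : ℝ → ℝ := fun x => ∫ r in 0..h, ψ (x - r)
  have hφs : tsupport φ ⊆ K := closure_minimal
    (fun x hx => by_contra fun hxK => hx (integral_comp_sub_eq_zero hh hxK)) hKc.isClosed
  have hweak : ∫ x, (ψ x - ψ (x - h)) • K.indicator p x = -∫ x, φ x • K.indicator g x := by
    have hφ := hpg φ (contDiff_integral_comp_sub hψ h)
      (hKc.of_isClosed_subset isClosed_closure hφs) (hφs.trans hKs)
    rw [setIntegral_smul_eq_integral_smul_indicator (support_deriv_subset.trans hφs) hKs,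
      setIntegral_smul_eq_integral_smul_indicator (subset_closure.trans hφs) hKs] at hφ
    simpa only [φ, (hasDerivAt_integral_comp_sub hψ.continuous h _).deriv] using hφ
  have hmem : ∀ y ∈ Function.support ψ, ∀ r ∈ Icc 0 h, y + r ∈ K := fun y hy r hr =>
    add_mem_add (subset_tsupport ψ hy) hr
  calc ∫ y, ψ y • (p (y + h) - p y)
      = ∫ y, ψ y • (K.indicator p (y + h) - K.indicator p y) := integral_smul_congr fun y hy => by
        have hyK := hmem y hy 0 ⟨le_rfl, hh⟩
        rw [add_zero] at hyK
        rw [indicator_of_mem (hmem y hy h ⟨hh, le_rfl⟩), indicator_of_mem hyK]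
    _ = ∫ x, φ x • K.indicator g x := by
        rw [← neg_inj, ← integral_smul_shift_sub hψ.continuous hψc hPint, hweak]
    _ = ∫ y, ψ y • ∫ r in 0..h, K.indicator g (y + r) :=
        integral_average_smul hψ.continuous hψc hQint hh
    _ = ∫ y, ψ y • ∫ r in 0..h, g (y + r) := integral_smul_congr fun y hy =>
        intervalIntegral.integral_congr fun r hr =>
          indicator_of_mem (hmem y hy r (uIcc_of_le hh ▸ hr)) g

theorem IsWeakDerivOn.sub_eq_integral
    (hp : ContinuousOn p (Ioi c)) (hg : LocallyIntegrableOn g (Ioi c))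
    (hpg : IsWeakDerivOn p g (Ioi c)) {s t : ℝ} (hs : c < s) (hst : s ≤ t) :
    p t - p s = ∫ r in s..t, g r := by
  have hh : 0 ≤ t - s := sub_nonneg.2 hst
  have hshift : MapsTo (· + (t - s)) (Ioi c) (Ioi c) := fun y (hy : c < y) =>
    hy.trans_le (le_add_of_nonneg_right hh)
  have hprim := continuousOn_primitive_Ioi hg hs
  have hincrement : ContinuousOn (fun y => p (y + (t - s)) - p y) (Ioi c) :=
    (hp.comp (by fun_prop) hshift).sub hp
  have hintegral : ContinuousOn (fun y => ∫ r in 0..t - s, g (y + r)) (Ioi c) := by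
    refine ((hprim.comp (by fun_prop) hshift).sub hprim).congr fun y hy => ?_
    have hint : ∀ x ∈ Ioi c, IntervalIntegrable g volume s x := fun x hx =>
      (hg.integrableOn_compact_subset
        (fun r hr => (lt_min hs hx).trans_le hr.1) isCompact_uIcc).intervalIntegrable
    change _ = (∫ r in s..y + (t - s), g r) - ∫ r in s..y, g r
    rw [intervalIntegral.integral_comp_add_left, add_zero,
      intervalIntegral.integral_interval_sub_left (hint _ (hshift hy)) (hint _ hy)]
  simpa only [intervalIntegral.integral_comp_add_left, add_sub_cancel, add_zero] using
    eqOn_of_integral_smul_eq isOpen_Ioi hincrement hintegral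
      (fun ψ hψ hψc hψs => IsWeakDerivOn.integral_smul_increment_eq hp hg hpg hψ hψc hψs hh) hs

end WeakDerivative

section Pairing

variable {V : Type*} [NormedAddCommGroup V] [NormedSpace ℝ V]

theorem integrable_pairing {α : Type*} [MeasurableSpace α] {μ : Measure α}
    {g : α → StrongDual ℝ V} {w : α → V} (hg : MemLp g 2 μ) (hw : MemLp w 2 μ) :
    Integrable (fun t => g t (w t)) μ :=
  memLp_one_iff_integrable.1
    ((ContinuousLinearMap.id ℝ (StrongDual ℝ V)).memLp_of_bilin 1 hg hw)

theorem continuous_translate_toLp {E : Type*} [NormedAddCommGroup E] {f : ℝ → E}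
    (hf : MemLp f 2 volume) :
    Continuous fun r : ℝ =>
      (hf.comp_measurePreserving (measurePreserving_add_right volume r)).toLp
        fun t => f (t + r) := by
  have : Fact ((2 : ℝ≥0∞) ≠ ⊤) := ⟨by simp⟩
  have hvadd : Continuous fun r : ℝ => DomAddAct.mk r +ᵥ hf.toLp f :=
    (DomAddAct.mkHomeomorph (M := ℝ)).continuous.vadd continuous_const
  refine hvadd.congr fun r => ?_
  rw [DomAddAct.mk_vadd_toLp]
  congr 1
  funext t
  simp [add_comm]

theorem continuous_translate_pairing {g : ℝ → StrongDual ℝ V} {w : ℝ → V}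
    (hg : MemLp g 2 volume) (hw : MemLp w 2 volume) (S : Set ℝ) :
    Continuous fun p : ℝ × ℝ => ∫ t in S, g (t + p.1) (w (t + p.2)) := by
  have hG := continuous_translate_toLp hg
  have hW := continuous_translate_toLp hw
  have hB := ((((ContinuousLinearMap.id ℝ (StrongDual ℝ V)).holderL volume 2 2 1).continuous.comp
    (hG.comp continuous_fst)).clm_apply (hW.comp continuous_snd))
  refine ((continuous_setIntegral S).comp hB).congr fun p => ?_
  refine integral_congr_ae (ae_restrict_of_ae ?_)
  filter_upwards [(ContinuousLinearMap.id ℝ (StrongDual ℝ V)).coeFn_holder (r := 1)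
      ((hg.comp_measurePreserving (measurePreserving_add_right volume p.1)).toLp
        (fun t => g (t + p.1)))
      ((hw.comp_measurePreserving (measurePreserving_add_right volume p.2)).toLp
        (fun t => w (t + p.2))),
    (hg.comp_measurePreserving (measurePreserving_add_right volume p.1)).coeFn_toLp,
    (hw.comp_measurePreserving (measurePreserving_add_right volume p.2)).coeFn_toLp]
    with t hB hG hW
  exact hB.trans (congr_arg₂ (fun (l : StrongDual ℝ V) x => l x) hG hW)

theorem integral_translate_pairing_comm {g : ℝ → StrongDual ℝ V} {w : ℝ → V}
    (hg : MemLp g 2 volume) (hw : MemLp w 2 volume) (S : Set ℝ) (h : ℝ) :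
    ∫ t in S, ∫ r in Ioc 0 h, g (t + r) (w (t + h)) =
      ∫ r in Ioc 0 h, ∫ t in S, g (t + r) (w (t + h)) := by
  refine integral_integral_swap ?_
  refine Integrable.mono_measure ?_ (Measure.prod_mono Measure.restrict_le_self le_rfl)
  refine integrable_pairing ?_ ?_
  · exact (hg.comp_fst (volume.restrict (Ioc 0 h))).comp_measurePreserving
      (measurePreserving_add_prod (volume : Measure ℝ) (volume.restrict (Ioc 0 h)))
  · exact (hw.comp_measurePreserving (measurePreserving_add_right volume h)).comp_fst
      (volume.restrict (Ioc 0 h))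

end Pairing

section Energy

theorem tendsto_average_diagonal {B : ℝ × ℝ → ℝ} (hB : Continuous B) :
    Tendsto (fun h => h⁻¹ * ∫ r in 0..h, B (r, h)) (𝓝[>] 0) (𝓝 (B 0)) := by
  have hcont : Continuous fun h => ∫ σ in (0 : ℝ)..1, B (h * σ, h) :=
    intervalIntegral.continuous_parametric_intervalIntegral_of_continuous' (by fun_prop) 0 1
  have hlim := (hcont.tendsto 0).mono_left (nhdsWithin_le_nhds (s := Ioi 0))
  simp only [zero_mul, intervalIntegral.integral_const, sub_zero, one_smul] at hlim
  refine hlim.congr' ?_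
  filter_upwards [self_mem_nhdsWithin] with h hh
  rw [intervalIntegral.integral_comp_mul_left (fun r => B (r, h)) (ne_of_gt hh), mul_zero, mul_one,
    smul_eq_mul]

variable {V H : Type*} [NormedAddCommGroup V] [NormedSpace ℝ V]
  [NormedAddCommGroup H] [InnerProductSpace ℝ H]

theorem norm_sq_sub_norm_sq_le_two_mul_inner (x y : H) :
    ‖x‖ ^ 2 - ‖y‖ ^ 2 ≤ 2 * inner ℝ (x - y) x := by
  rw [inner_sub_left, real_inner_self_eq_norm_sq, real_inner_comm]
  linarith [norm_sub_sq_real x y, sq_nonneg ‖x - y‖]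

variable {j : V → H} {u : ℝ → H} {w : ℝ → V} {g : ℝ → StrongDual ℝ V} {s τ b : ℝ}

theorem ae_integral_pairing_eq_inner
    (hwu : ∀ᵐ t : ℝ, t ∈ Ioc s b → j (w t) = u t)
    (hderiv : ∀ v s' t', s < s' → s' ≤ t' → t' ≤ b →
      inner ℝ (u t') (j v) - inner ℝ (u s') (j v) = ∫ r in s'..t', g r v)
    {h : ℝ} (hh : 0 ≤ h) (hτh : τ + h ≤ b) :
    ∀ᵐ t ∂volume.restrict (Ioc s τ),
      ∫ r in 0..h, g (t + r) (w (t + h)) = inner ℝ (u (t + h) - u t) (u (t + h)) := by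
  rw [ae_restrict_iff' measurableSet_Ioc]
  filter_upwards [(measurePreserving_add_right volume h).quasiMeasurePreserving.ae hwu]
    with t ht htI
  have hincrement := hderiv (w (t + h)) t (t + h) htI.1 (by linarith) (by linarith [htI.2])
  rw [ht ⟨by linarith [htI.1], by linarith [htI.2]⟩, ← inner_sub_left] at hincrement
  rw [hincrement, intervalIntegral.integral_comp_add_left (fun r => g r (w (t + h))), add_zero]

theorem integral_norm_sq_increment_le (hu : Continuous u) (hg : MemLp g 2 volume)
    (hw : MemLp w 2 volume) (hsτ : s ≤ τ) (hwu : ∀ᵐ t : ℝ, t ∈ Ioc s b → j (w t) = u t)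
    (hderiv : ∀ v s' t', s < s' → s' ≤ t' → t' ≤ b →
      inner ℝ (u t') (j v) - inner ℝ (u s') (j v) = ∫ r in s'..t', g r v)
    {h : ℝ} (hh : 0 ≤ h) (hτh : τ + h ≤ b) :
    (∫ t in s..τ, ‖u (t + h)‖ ^ 2) - ∫ t in s..τ, ‖u t‖ ^ 2 ≤
      2 * ∫ r in 0..h, ∫ t in Ioc s τ, g (t + r) (w (t + h)) := by
  have hinner := ae_integral_pairing_eq_inner hwu hderiv hh hτh
  have hinnerint : IntegrableOn (fun t => inner ℝ (u (t + h) - u t) (u (t + h))) (Ioc s τ) :=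
    Continuous.integrableOn_Ioc (by fun_prop)
  calc (∫ t in s..τ, ‖u (t + h)‖ ^ 2) - ∫ t in s..τ, ‖u t‖ ^ 2
      = ∫ t in Ioc s τ, (‖u (t + h)‖ ^ 2 - ‖u t‖ ^ 2) := by
        rw [← intervalIntegral.integral_of_le hsτ, intervalIntegral.integral_sub] <;>
          exact Continuous.intervalIntegrable (by fun_prop) _ _
    _ ≤ ∫ t in Ioc s τ, 2 * inner ℝ (u (t + h) - u t) (u (t + h)) :=
        integral_mono (Continuous.integrableOn_Ioc (by fun_prop)) (hinnerint.const_mul 2)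
          fun t => norm_sq_sub_norm_sq_le_two_mul_inner _ _
    _ = 2 * ∫ t in Ioc s τ, ∫ r in 0..h, g (t + r) (w (t + h)) := by
        rw [integral_const_mul, integral_congr_ae hinner]
    _ = 2 * ∫ r in 0..h, ∫ t in Ioc s τ, g (t + r) (w (t + h)) := by
        simp only [intervalIntegral.integral_of_le hh]
        rw [integral_translate_pairing_comm hg hw]

theorem norm_sq_sub_norm_sq_le_integral_pairing (hu : Continuous u) (hg : MemLp g 2 volume)
    (hw : MemLp w 2 volume) (hsτ : s ≤ τ) (hτb : τ < b)
    (hwu : ∀ᵐ t : ℝ, t ∈ Ioc s b → j (w t) = u t)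
    (hderiv : ∀ v s' t', s < s' → s' ≤ t' → t' ≤ b →
      inner ℝ (u t') (j v) - inner ℝ (u s') (j v) = ∫ r in s'..t', g r v) :
    ‖u τ‖ ^ 2 - ‖u s‖ ^ 2 ≤ 2 * ∫ t in Ioc s τ, g t (w t) := by
  have hslope := hasDerivAt_integral_comp_add (f := fun t => ‖u t‖ ^ 2) (by fun_prop) s τ 0
    |>.tendsto_slope_zero_right
  have haverage := (tendsto_average_diagonal
    (continuous_translate_pairing hg hw (Ioc s τ))).const_mul 2
  simp only [add_zero, zero_add] at hslope
  simp only [Prod.fst_zero, Prod.snd_zero, add_zero] at haverage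
  refine le_of_tendsto_of_tendsto hslope haverage ?_
  filter_upwards [Ioo_mem_nhdsGT (sub_pos.2 hτb)] with h hh
  rw [smul_eq_mul, mul_left_comm]
  exact mul_le_mul_of_nonneg_left (integral_norm_sq_increment_le hu hg hw hsτ hwu hderiv
    hh.1.le (by linarith [hh.2])) (inv_nonneg.2 hh.1.le)

theorem MemL2Loc.memLp_indicator {X : Type*} [NormedAddCommGroup X] {z : ℝ → X}
    (hz : MemL2Loc z) {T : ℝ} (hT : 0 < T) : MemLp ((Ioc 0 T).indicator z) 2 volume :=
  (memLp_indicator_iff_restrict measurableSet_Ioc).2 (hz T hT)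

theorem energy_inequality (hu : ContinuousOn u (Ici 0)) {U : ℝ → V} {G : ℝ → StrongDual ℝ V}
    (hU : MemL2Loc U) (hG : MemL2Loc G)
    (hUu : ∀ᵐ t ∂volume.restrict (Ioi (0 : ℝ)), j (U t) = u t)
    (hderiv : ∀ v s t, 0 < s → s ≤ t →
      inner ℝ (u t) (j v) - inner ℝ (u s) (j v) = ∫ r in s..t, G r v)
    (hs : 0 ≤ s) (hsτ : s ≤ τ) :
    ‖u τ‖ ^ 2 - ‖u s‖ ^ 2 ≤ 2 * ∫ t in Ioc s τ, G t (U t) := by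
  have hb : 0 < τ + 1 := by linarith
  set I := Ioc 0 (τ + 1)
  set u' : ℝ → H := fun t => u (max t 0)
  have hu' : Continuous u' := hu.comp_continuous (by fun_prop) fun t => le_max_right t 0
  have hextend : ∀ t, 0 ≤ t → u' t = u t := fun t ht => congrArg u (max_eq_left ht)
  have hUI : ∀ᵐ t : ℝ, t ∈ Ioc s (τ + 1) → j (I.indicator U t) = u' t := by
    filter_upwards [(ae_restrict_iff' measurableSet_Ioi).1 hUu] with t ht htI
    have ht0 := hs.trans_lt htI.1
    rw [indicator_of_mem (show t ∈ I from ⟨ht0, htI.2⟩), ht ht0, hextend t ht0.le]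
  have hGI : ∀ v s' t', s < s' → s' ≤ t' → t' ≤ τ + 1 →
      inner ℝ (u' t') (j v) - inner ℝ (u' s') (j v) = ∫ r in s'..t', I.indicator G r v := by
    intro v s' t' hs' hst' ht'
    have hs0 := hs.trans_lt hs'
    rw [hextend t' (hs0.le.trans hst'), hextend s' hs0.le, hderiv v s' t' hs0 hst']
    refine intervalIntegral.integral_congr fun r hr => ?_
    rw [uIcc_of_le hst'] at hr
    simp only [indicator_of_mem (show r ∈ I from ⟨hs0.trans_le hr.1, hr.2.trans ht'⟩)]
  rw [← hextend τ (hs.trans hsτ), ← hextend s hs]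
  refine (norm_sq_sub_norm_sq_le_integral_pairing hu' (hG.memLp_indicator hb)
    (hU.memLp_indicator hb) hsτ (lt_add_one τ) hUI hGI).trans_eq ?_
  congr 1
  refine setIntegral_congr_fun measurableSet_Ioc fun t ht => ?_
  have htI : t ∈ Ioc 0 (τ + 1) := ⟨hs.trans_lt ht.1, by linarith [ht.2]⟩
  simp only [indicator_of_mem htI]

end Energy

section Comparison

variable {Λ : ℝ → ℝ≥0∞}

theorem ne_zero_of_lintegral_inv_lt_top (hmono : MonotoneOn Λ (Ioi 0))
    (hint : (∫⁻ h in Ioc (0 : ℝ) 1, (Λ h)⁻¹) < ⊤) {h : ℝ} (hh : 0 < h) : Λ h ≠ 0 := by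
  intro hΛh
  have hpos : 0 < min h 1 := lt_min hh one_pos
  have hzero : ∀ r ∈ Ioc 0 (min h 1), Λ r = 0 := fun r hr =>
    le_antisymm ((hmono hr.1 hh (hr.2.trans (min_le_left _ _))).trans_eq hΛh) zero_le
  refine hint.ne (top_unique ?_)
  calc (⊤ : ℝ≥0∞) = ∫⁻ _ in Ioc (0 : ℝ) (min h 1), ⊤ := by
        rw [setLIntegral_const, Real.volume_Ioc, sub_zero,
          ENNReal.top_mul (ENNReal.ofReal_pos.2 hpos).ne']
    _ = ∫⁻ r in Ioc (0 : ℝ) (min h 1), (Λ r)⁻¹ :=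
        setLIntegral_congr_fun measurableSet_Ioc fun r hr => by
          rw [hzero r hr, ENNReal.inv_zero]
    _ ≤ ∫⁻ r in Ioc (0 : ℝ) 1, (Λ r)⁻¹ :=
        lintegral_mono_set (Ioc_subset_Ioc_right (min_le_right _ _))

theorem lintegral_inv_lt_top (hmono : MonotoneOn Λ (Ioi 0))
    (hint : (∫⁻ h in Ioc (0 : ℝ) 1, (Λ h)⁻¹) < ⊤) (R : ℝ) :
    (∫⁻ h in Ioc (0 : ℝ) R, (Λ h)⁻¹) < ⊤ := by
  have htail : (∫⁻ r in Ioc (1 : ℝ) R, (Λ r)⁻¹) < ⊤ :=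
    calc ∫⁻ r in Ioc (1 : ℝ) R, (Λ r)⁻¹ ≤ ∫⁻ _ in Ioc (1 : ℝ) R, (Λ 1)⁻¹ :=
          setLIntegral_mono measurable_const fun r hr =>
            ENNReal.inv_le_inv.2 (hmono (mem_Ioi.2 one_pos) (one_pos.trans hr.1) hr.1.le)
      _ < ⊤ := by
          rw [setLIntegral_const, Real.volume_Ioc]
          exact ENNReal.mul_lt_top (ENNReal.inv_lt_top.2 (pos_iff_ne_zero.2
            (ne_zero_of_lintegral_inv_lt_top hmono hint one_pos))) ENNReal.ofReal_lt_top
  exact ((lintegral_mono_set Ioc_subset_Ioc_union_Ioc).trans (lintegral_union_le _ _ _)).trans_lt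
    (ENNReal.add_lt_top.2 ⟨hint, htail⟩)

theorem ofReal_mul_inv_le_lintegral_inv (hmono : MonotoneOn Λ (Ioi 0)) {δ h : ℝ} (hδh : δ ≤ h) :
    ENNReal.ofReal δ * (Λ h)⁻¹ ≤ ∫⁻ r in Ioc (h - δ) h, (Λ r)⁻¹ :=
  calc ENNReal.ofReal δ * (Λ h)⁻¹ = ∫⁻ _ in Ioc (h - δ) h, (Λ h)⁻¹ := by
        rw [setLIntegral_const, Real.volume_Ioc, sub_sub_cancel, mul_comm]
    _ ≤ ∫⁻ r in Ioc (h - δ) h, (Λ r)⁻¹ := setLIntegral_mono' measurableSet_Ioc fun r hr =>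
        have hr0 : 0 < r := (sub_nonneg.2 hδh).trans_lt hr.1
        ENNReal.inv_le_inv.2 (hmono hr0 (hr0.trans_le hr.2) hr.2)

theorem lintegral_Ioc_add_lintegral_Ioc {f : ℝ → ℝ≥0∞} {a b c : ℝ} (hab : a ≤ b) (hbc : b ≤ c) :
    (∫⁻ x in Ioc a b, f x) + ∫⁻ x in Ioc b c, f x = ∫⁻ x in Ioc a c, f x := by
  rw [← lintegral_union measurableSet_Ioc (Ioc_disjoint_Ioc_of_le le_rfl),
    Ioc_union_Ioc_eq_Ioc hab hbc]

/-- The differential inequality `y' ≤ -κ Λ(y)` on `[0, ∞)`, integrated over `[s, t]` with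
`Λ(y)` bounded below by its value at `t`. -/
def DecaysAtRate (κ : ℝ) (Λ : ℝ → ℝ≥0∞) (y : ℝ → ℝ) : Prop :=
  ∀ s t, 0 ≤ s → s ≤ t → ENNReal.ofReal (κ * (t - s)) * Λ (y t) ≤ ENNReal.ofReal (y s - y t)

variable {y : ℝ → ℝ} {κ : ℝ}

-- A drop of `y` from `h + δ` to `h` is charged to `(h - δ, h]`, where `1 / Λ ≥ 1 / Λ(h)`.
theorem DecaysAtRate.ofReal_mul_le_lintegral_inv_of_eq_sub (hmono : MonotoneOn Λ (Ioi 0))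
    (hΛ : ∀ h, 0 < h → Λ h ≠ 0) (hy : ContinuousOn y (Ici 0))
    (hdecay : DecaysAtRate κ Λ y) {δ : ℝ} (hδ : 0 < δ) (k : ℕ) {t : ℝ} (ht : 0 ≤ t)
    (hyt : y t = y 0 - k * δ) (hδt : δ ≤ y t) :
    ENNReal.ofReal (κ * t) ≤ ∫⁻ h in Ioc (y t - δ) (y 0 - δ), (Λ h)⁻¹ := by
  induction k generalizing t with
  | zero =>
    have hzero := hdecay 0 t le_rfl ht
    rw [Nat.cast_zero, zero_mul, sub_zero] at hyt
    rw [hyt, sub_self, sub_zero, ENNReal.ofReal_zero, nonpos_iff_eq_zero, mul_eq_zero,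
      or_iff_left (hΛ _ (hyt ▸ hδ.trans_le hδt))] at hzero
    exact hzero ▸ zero_le
  | succ k ih =>
    push_cast at hyt
    obtain ⟨s, ⟨hs, hst⟩, hys⟩ : y 0 - k * δ ∈ y '' Icc 0 t :=
      intermediate_value_Icc' ht (hy.mono Icc_subset_Ici_self)
        ⟨by linarith, sub_le_self _ (by positivity)⟩
    have hstep : y s - y t = δ := by linarith
    have hfirst : ENNReal.ofReal (κ * s) ≤ ∫⁻ h in Ioc (y t) (y 0 - δ), (Λ h)⁻¹ := by
      have hih := ih hs hys (by linarith)
      rwa [← hstep, sub_sub_cancel, hstep] at hih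
    have hsecond : ENNReal.ofReal (κ * (t - s)) ≤ ∫⁻ h in Ioc (y t - δ) (y t), (Λ h)⁻¹ := by
      refine le_trans ?_ (ofReal_mul_inv_le_lintegral_inv hmono hδt)
      rw [← div_eq_mul_inv, ENNReal.le_div_iff_mul_le (.inl (hΛ _ (hδ.trans_le hδt)))
        (.inr ENNReal.ofReal_ne_top), ← hstep]
      exact hdecay s t hs hst
    calc ENNReal.ofReal (κ * t) = ENNReal.ofReal (κ * (t - s) + κ * s) := by ring_nf
      _ ≤ ENNReal.ofReal (κ * (t - s)) + ENNReal.ofReal (κ * s) := ENNReal.ofReal_add_le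
      _ ≤ (∫⁻ h in Ioc (y t - δ) (y t), (Λ h)⁻¹) + ∫⁻ h in Ioc (y t) (y 0 - δ), (Λ h)⁻¹ :=
          add_le_add hsecond hfirst
      _ = ∫⁻ h in Ioc (y t - δ) (y 0 - δ), (Λ h)⁻¹ :=
          lintegral_Ioc_add_lintegral_Ioc (sub_le_self _ hδ.le)
            (by nlinarith [mul_nonneg k.cast_nonneg hδ.le])

theorem DecaysAtRate.ofReal_mul_le_lintegral_inv (hmono : MonotoneOn Λ (Ioi 0))
    (hΛ : ∀ h, 0 < h → Λ h ≠ 0) (hy : ContinuousOn y (Ici 0))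
    (hdecay : DecaysAtRate κ Λ y) {T : ℝ} (hT : 0 ≤ T) (hyT : 0 < y T) :
    ENNReal.ofReal (κ * T) ≤ ∫⁻ h in Ioc 0 (y 0), (Λ h)⁻¹ := by
  obtain hle | hlt := le_or_gt (y 0) (y T)
  · have hzero := hdecay 0 T le_rfl hT
    rw [ENNReal.ofReal_of_nonpos (sub_nonpos.2 hle), nonpos_iff_eq_zero, mul_eq_zero,
      or_iff_left (hΛ _ hyT), sub_zero] at hzero
    exact hzero ▸ zero_le
  · obtain ⟨n, hn⟩ := exists_nat_gt ((y 0 - y T) / y T)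
    have hn0 : (0 : ℝ) < n := (div_pos (sub_pos.2 hlt) hyT).trans hn
    set δ := (y 0 - y T) / n with hδ
    have hδ0 : 0 < δ := div_pos (sub_pos.2 hlt) hn0
    have hδT : δ ≤ y T := ((div_lt_comm₀ hyT hn0).1 hn).le
    have hsteps : y T = y 0 - n * δ := by
      rw [hδ, mul_div_cancel₀ _ hn0.ne', sub_sub_cancel]
    exact (hdecay.ofReal_mul_le_lintegral_inv_of_eq_sub hmono hΛ hy hδ0 n hT hsteps hδT).trans
      (lintegral_mono_set (Ioc_subset_Ioc (sub_nonneg.2 hδT) (sub_le_self _ hδ0.le)))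

theorem DecaysAtRate.eq_zero_of_le (hΛ : ∀ h, 0 < h → Λ h ≠ 0) (hκ : 0 < κ)
    (hy0 : ∀ t, 0 ≤ t → 0 ≤ y t) (hdecay : DecaysAtRate κ Λ y) {s t : ℝ} (hs : 0 ≤ s)
    (hys : y s = 0) (hst : s ≤ t) : y t = 0 := by
  obtain rfl | hlt := hst.eq_or_lt
  · exact hys
  have hyt := hy0 t (hs.trans hst)
  have hzero := hdecay s t hs hst
  rw [hys, zero_sub, ENNReal.ofReal_of_nonpos (neg_nonpos.2 hyt), nonpos_iff_eq_zero,
    mul_eq_zero, or_iff_right (ENNReal.ofReal_pos.2 (mul_pos hκ (sub_pos.2 hlt))).ne'] at hzero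
  exact hyt.antisymm' (not_lt.1 fun hpos => hΛ _ hpos hzero)

theorem DecaysAtRate.exists_isLeast_forall_ge_eq_zero (hmono : MonotoneOn Λ (Ioi 0))
    (hint : (∫⁻ h in Ioc (0 : ℝ) 1, (Λ h)⁻¹) < ⊤) (hκ : 0 < κ)
    (hy : ContinuousOn y (Ici 0)) (hy0 : ∀ t, 0 ≤ t → 0 ≤ y t)
    (hdecay : DecaysAtRate κ Λ y) :
    ∃ T, IsLeast {s | 0 ≤ s ∧ ∀ t, s ≤ t → y t = 0} T ∧
      ENNReal.ofReal T ≤ ENNReal.ofReal (1 / κ) * ∫⁻ h in Ioc 0 (y 0), (Λ h)⁻¹ := by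
  have hΛ : ∀ h, 0 < h → Λ h ≠ 0 := fun h => ne_zero_of_lintegral_inv_lt_top hmono hint
  set B := ENNReal.ofReal (1 / κ) * ∫⁻ h in Ioc 0 (y 0), (Λ h)⁻¹
  have hB : B ≠ ⊤ :=
    ENNReal.mul_ne_top ENNReal.ofReal_ne_top (lintegral_inv_lt_top hmono hint (y 0)).ne
  have htime : ∀ t, 0 ≤ t → y t ≠ 0 → t ≤ B.toReal := by
    intro t ht hyt
    have hκt := hdecay.ofReal_mul_le_lintegral_inv hmono hΛ hy ht ((hy0 t ht).lt_of_ne' hyt)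
    rw [← ENNReal.ofReal_le_iff_le_toReal hB]
    calc ENNReal.ofReal t = ENNReal.ofReal (1 / κ) * ENNReal.ofReal (κ * t) := by
          rw [← ENNReal.ofReal_mul (by positivity), one_div, inv_mul_cancel_left₀ hκ.ne']
      _ ≤ B := mul_le_mul_right hκt _
  set Z : Set ℝ := Ici 0 ∩ y ⁻¹' {0}
  have hZbdd : BddBelow Z := ⟨0, fun t ht => ht.1⟩
  have hZne : Z.Nonempty := by
    refine ⟨B.toReal + 1, mem_Ici.2 (by positivity), ?_⟩
    by_contra hne
    linarith [htime _ (by positivity) hne]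
  have hT : sInf Z ∈ Z := (hy.preimage_isClosed_of_isClosed isClosed_Ici
    isClosed_singleton).csInf_mem hZne hZbdd
  refine ⟨sInf Z, ⟨⟨hT.1, fun t ht => hdecay.eq_zero_of_le hΛ hκ hy0 hT.1 hT.2 ht⟩,
    fun s hs => csInf_le hZbdd ⟨hs.1, hs.2 s le_rfl⟩⟩, ?_⟩
  refine (ENNReal.ofReal_le_iff_le_toReal hB).2 (le_of_forall_lt_imp_le_of_dense fun t ht => ?_)
  obtain ht0 | ht0 := lt_or_ge t 0
  · exact ht0.le.trans ENNReal.toReal_nonneg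
  · exact htime t ht0 fun hyt => (csInf_le hZbdd ⟨ht0, hyt⟩).not_gt ht

end Comparison

section Functional

variable {N m : ℕ} {Ω : Set (EuclideanSpace ℝ (Fin N))} {a : EuclideanSpace ℝ (Fin N) → ℝ} {q : ℝ}

theorem W0.topSq_nonneg (v : W0 m Ω) (x : EuclideanSpace ℝ (Fin N)) : 0 ≤ W0.topSq v x :=
  Finset.sum_nonneg fun _ _ => by positivity

theorem W0.fn_smul (σ : ℝ) (v : W0 m Ω) : W0.fn (σ • v) = σ • W0.fn v := rfl

theorem W0.topSq_smul (σ : ℝ) (v : W0 m Ω) :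
    ∀ᵐ x ∂volume.restrict Ω, W0.topSq (σ • v) x = σ ^ 2 * W0.topSq v x := by
  have hsmul : ∀ᵐ x ∂volume.restrict Ω, ∀ α : TopIndex N m,
      W0.D (σ • v) α.1 x = σ * W0.D v α.1 x :=
    ae_all_iff.2 fun α => Lp.coeFn_smul σ (W0.D v α.1)
  filter_upwards [hsmul] with x hx
  simp only [W0.topSq, hx, Finset.mul_sum, abs_mul, mul_pow, sq_abs]

theorem W0.integrable_topSq (v : W0 m Ω) : IntegrableOn (W0.topSq v) Ω := by
  refine integrable_finsetSum _ fun α _ => ?_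
  simpa only [sq_abs] using (Lp.memLp (W0.D v α.1)).integrable_sq

/-- The density `|D^m v|² + a |v|^{1+q}` of the functional minimised in `lambda1`. -/
noncomputable def energyDensity (a : EuclideanSpace ℝ (Fin N) → ℝ) (q : ℝ) (v : W0 m Ω)
    (x : EuclideanSpace ℝ (Fin N)) : ℝ :=
  W0.topSq v x + a x * |W0.fn v x| ^ (1 + q)

theorem energyDensity_nonneg (ha : ∀ᵐ x ∂volume.restrict Ω, 0 ≤ a x) (v : W0 m Ω) :
    ∀ᵐ x ∂volume.restrict Ω, 0 ≤ energyDensity a q v x :=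
  ha.mono fun x hx => add_nonneg (W0.topSq_nonneg v x) (mul_nonneg hx (by positivity))

theorem integrable_energyDensity {v : W0 m Ω}
    (hav : IntegrableOn (fun x => a x * |W0.fn v x| ^ (1 + q)) Ω) :
    IntegrableOn (energyDensity a q v) Ω :=
  (W0.integrable_topSq v).add hav

theorem energyDensity_smul_le (hq : -1 ≤ q) (ha : ∀ᵐ x ∂volume.restrict Ω, 0 ≤ a x)
    {σ : ℝ} (hσ₀ : 0 ≤ σ) (hσ₁ : σ ≤ 1) (v : W0 m Ω) :
    ∀ᵐ x ∂volume.restrict Ω, energyDensity a q (σ • v) x ≤ energyDensity a q v x := by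
  filter_upwards [W0.topSq_smul σ v, Lp.coeFn_smul σ (W0.fn v), ha] with x htop hfn hax
  rw [energyDensity, htop, W0.fn_smul, hfn, Pi.smul_apply, smul_eq_mul, abs_mul,
    abs_of_nonneg hσ₀]
  refine add_le_add (mul_le_of_le_one_left (W0.topSq_nonneg v x) (pow_le_one₀ hσ₀ hσ₁))
    (mul_le_mul_of_nonneg_left ?_ hax)
  exact Real.rpow_le_rpow (by positivity) (mul_le_of_le_one_left (abs_nonneg _) hσ₁)
    (by linarith)

theorem lambda1_le_lintegral {v : W0 m Ω} {h : ℝ} (hv : ‖W0.fn v‖ ^ 2 = h) :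
    lambda1 m Ω a q h ≤ ∫⁻ x in Ω, ENNReal.ofReal (energyDensity a q v x) :=
  iInf₂_le_of_le v hv le_rfl

theorem monotoneOn_lambda1 (hq : -1 ≤ q) (ha : ∀ᵐ x ∂volume.restrict Ω, 0 ≤ a x) :
    MonotoneOn (lambda1 m Ω a q) (Ici 0) := by
  intro h hh h' hh' hhh'
  refine le_iInf₂ fun v hv => ?_
  have hσ : ‖W0.fn (√(h / h') • v)‖ ^ 2 = h := by
    rw [W0.fn_smul, norm_smul, mul_pow, hv, Real.norm_eq_abs, sq_abs,
      Real.sq_sqrt (div_nonneg hh hh')]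
    exact div_mul_cancel_of_imp fun hz => le_antisymm (hz ▸ hhh') hh
  calc lambda1 m Ω a q h
      ≤ ∫⁻ x in Ω, ENNReal.ofReal (energyDensity a q (√(h / h') • v) x) :=
        lambda1_le_lintegral hσ
    _ ≤ ∫⁻ x in Ω, ENNReal.ofReal (energyDensity a q v x) :=
        lintegral_mono_ae ((energyDensity_smul_le hq ha (Real.sqrt_nonneg _)
          (Real.sqrt_le_one.2 (div_le_one_of_le₀ hhh' hh')) v).mono fun x hx =>
            ENNReal.ofReal_le_ofReal hx)

variable {A : Coeff N m} {C : ℝ}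

-- A non-integrable flux would have integral `0`, so coercivity would force `D^m v = 0` a.e.
theorem IsCoercive.integrable_fluxDensity (hC : 0 < C) (hcoer : IsCoercive Ω A C) (v : W0 m Ω) :
    IntegrableOn (fluxDensity A v v) Ω := by
  by_contra hni
  have hle : C * ∫ x in Ω, W0.topSq v x ≤ 0 := (hcoer v).trans_eq (integral_undef hni)
  have hzero : ∫ x in Ω, W0.topSq v x = 0 :=
    (nonpos_of_mul_nonpos_right hle hC).antisymm (integral_nonneg (W0.topSq_nonneg v))
  rw [integral_eq_zero_iff_of_nonneg (W0.topSq_nonneg v) (W0.integrable_topSq v)] at hzero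
  refine hni ((integrable_zero _ _ _).congr ?_)
  filter_upwards [hzero] with x hx
  have hD := (Finset.sum_eq_zero_iff_of_nonneg fun α _ => by positivity).1 hx
  refine (Finset.sum_eq_zero fun α hα => ?_).symm
  rw [abs_eq_zero.1 (pow_eq_zero_iff two_ne_zero |>.1 (hD α hα)), mul_zero]

theorem abs_rpow_sub_one_mul_mul_self (hq : 1 + q ≠ 0) (r : ℝ) :
    |r| ^ (q - 1) * r * r = |r| ^ (1 + q) := by
  obtain rfl | hr := eq_or_ne r 0
  · rw [abs_zero, Real.zero_rpow hq, mul_zero]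
  · rw [mul_assoc, ← abs_mul_abs_self, ← mul_assoc, ← Real.rpow_add_one (abs_ne_zero.2 hr),
      ← Real.rpow_add_one (abs_ne_zero.2 hr)]
    ring_nf

/-- The integral `∫_Ω (∑ a_α(x, v, …, D^m v) D^α v + a |v|^{q-1} v · v) dx`, which is half the rate
at which a weak solution passing through `v` loses `‖u‖²`. -/
noncomputable def dissipation (A : Coeff N m) (a : EuclideanSpace ℝ (Fin N) → ℝ) (q : ℝ)
    (v : W0 m Ω) : ℝ :=
  ∫ x in Ω, (fluxDensity A v v x + a x * (|W0.fn v x| ^ (q - 1) * W0.fn v x) * W0.fn v x)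

theorem IsCoercive.mul_integral_energyDensity_le_dissipation (hq : 1 + q ≠ 0)
    (ha : ∀ᵐ x ∂volume.restrict Ω, 0 ≤ a x) (hC : 0 < C) (hcoer : IsCoercive Ω A C) {v : W0 m Ω}
    (hav : IntegrableOn (fun x => a x * |W0.fn v x| ^ (1 + q)) Ω) :
    min 1 C * ∫ x in Ω, energyDensity a q v x ≤ dissipation A a q v := by
  have htop : 0 ≤ ∫ x in Ω, W0.topSq v x := integral_nonneg (W0.topSq_nonneg v)
  have habs : 0 ≤ ∫ x in Ω, a x * |W0.fn v x| ^ (1 + q) :=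
    integral_nonneg_of_ae (ha.mono fun x hx => mul_nonneg hx (by positivity))
  calc min 1 C * ∫ x in Ω, energyDensity a q v x
      = min 1 C * (∫ x in Ω, W0.topSq v x) +
          min 1 C * ∫ x in Ω, a x * |W0.fn v x| ^ (1 + q) := by
        rw [← mul_add, ← integral_add (W0.integrable_topSq v) hav]; rfl
    _ ≤ C * (∫ x in Ω, W0.topSq v x) + ∫ x in Ω, a x * |W0.fn v x| ^ (1 + q) :=
        add_le_add (mul_le_mul_of_nonneg_right (min_le_right 1 C) htop)
          (mul_le_of_le_one_left habs (min_le_left 1 C))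
    _ ≤ (∫ x in Ω, fluxDensity A v v x) + ∫ x in Ω, a x * |W0.fn v x| ^ (1 + q) := by
        gcongr
        exact hcoer v
    _ = dissipation A a q v := by
        rw [← integral_add (hcoer.integrable_fluxDensity hC v) hav]
        simp only [dissipation, mul_assoc (a _), abs_rpow_sub_one_mul_mul_self hq]

theorem IsCoercive.dissipation_nonneg (hq : 1 + q ≠ 0) (ha : ∀ᵐ x ∂volume.restrict Ω, 0 ≤ a x)
    (hC : 0 < C) (hcoer : IsCoercive Ω A C) {v : W0 m Ω}
    (hav : IntegrableOn (fun x => a x * |W0.fn v x| ^ (1 + q)) Ω) : 0 ≤ dissipation A a q v :=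
  (mul_nonneg (le_min zero_le_one hC.le)
    (integral_nonneg_of_ae (energyDensity_nonneg ha v))).trans
      (hcoer.mul_integral_energyDensity_le_dissipation hq ha hC hav)

theorem IsCoercive.ofReal_mul_lambda1_le_dissipation (hq : 1 + q ≠ 0)
    (ha : ∀ᵐ x ∂volume.restrict Ω, 0 ≤ a x) (hC : 0 < C) (hcoer : IsCoercive Ω A C) {v : W0 m Ω}
    (hav : IntegrableOn (fun x => a x * |W0.fn v x| ^ (1 + q)) Ω) :
    ENNReal.ofReal (min 1 C) * lambda1 m Ω a q (‖W0.fn v‖ ^ 2) ≤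
      ENNReal.ofReal (dissipation A a q v) :=
  calc ENNReal.ofReal (min 1 C) * lambda1 m Ω a q (‖W0.fn v‖ ^ 2)
      ≤ ENNReal.ofReal (min 1 C) * ∫⁻ x in Ω, ENNReal.ofReal (energyDensity a q v x) :=
        mul_le_mul_right (lambda1_le_lintegral rfl) _
    _ = ENNReal.ofReal (min 1 C * ∫ x in Ω, energyDensity a q v x) := by
        rw [ENNReal.ofReal_mul (le_min zero_le_one hC.le), ofReal_integral_eq_lintegral_ofReal
          (integrable_energyDensity hav) (energyDensity_nonneg ha v)]
    _ ≤ ENNReal.ofReal (dissipation A a q v) := ENNReal.ofReal_le_ofReal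
        (hcoer.mul_integral_energyDensity_le_dissipation hq ha hC hav)

end Functional

section Solution

variable {N m : ℕ} {Ω : Set (EuclideanSpace ℝ (Fin N))}

theorem MemL2Loc.locallyIntegrableOn_apply {V : Type*} [NormedAddCommGroup V] [NormedSpace ℝ V]
    {G : ℝ → StrongDual ℝ V} (hG : MemL2Loc G) (v : V) :
    LocallyIntegrableOn (fun t => G t v) (Ioi 0) := fun t (ht : 0 < t) =>
  ⟨Ioc 0 (t + 1), inter_mem_nhdsWithin _ (Iic_mem_nhds (lt_add_one t)),
    integrable_pairing (hG (t + 1) (by linarith)) (memLp_const v)⟩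

theorem IsTimeDeriv.inner_sub_inner_eq_integral {u : ℝ → L2 Ω} {G : ℝ → StrongDual ℝ (W0 m Ω)}
    (huG : IsTimeDeriv u G) (hu : ContinuousOn u (Ioi 0)) (hG : MemL2Loc G) (w : W0 m Ω) (s t : ℝ)
    (hs : 0 < s) (hst : s ≤ t) :
    inner ℝ (u t) (W0.fn w) - inner ℝ (u s) (W0.fn w) = ∫ r in s..t, G r w :=
  IsWeakDerivOn.sub_eq_integral (p := fun t => inner ℝ (u t) (W0.fn w))
    (hu.inner continuousOn_const) (hG.locallyIntegrableOn_apply w) (huG w) hs hst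

theorem setIntegral_Ioc_eq_zero {f : ℝ → ℝ}
    (hf : ∀ T, 0 < T → IntegrableOn f (Ioc 0 T) ∧ ∫ t in Ioc 0 T, f t = 0) {s t : ℝ} (hs : 0 ≤ s)
    (hst : s ≤ t) : ∫ r in Ioc s t, f r = 0 := by
  have hinterval : ∀ T, 0 ≤ T → IntervalIntegrable f volume 0 T ∧ ∫ r in 0..T, f r = 0 := by
    intro T hT
    obtain rfl | hT := hT.eq_or_lt
    · exact ⟨IntervalIntegrable.refl, intervalIntegral.integral_same⟩
    · rw [intervalIntegrable_iff_integrableOn_Ioc_of_le hT.le,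
        intervalIntegral.integral_of_le hT.le]
      exact hf T hT
  have ⟨hint_s, hzero_s⟩ := hinterval s hs
  have ⟨hint_t, hzero_t⟩ := hinterval t (hs.trans hst)
  rw [← intervalIntegral.integral_of_le hst,
    ← intervalIntegral.integral_interval_sub_left hint_t hint_s, hzero_s, hzero_t, sub_zero]

variable {A : Coeff N m} {a : EuclideanSpace ℝ (Fin N) → ℝ} {q C : ℝ} {u₀ : L2 Ω} {u : ℝ → L2 Ω}

theorem IsWeakSolution.exists_dissipation_le (hu : IsWeakSolution A a q u₀ u) :
    ∃ U : ℝ → W0 m Ω, (∀ᵐ t ∂volume.restrict (Ioi (0 : ℝ)), W0.fn (U t) = u t) ∧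
      ∀ s t, 0 ≤ s → s ≤ t → IntegrableOn (fun r => dissipation A a q (U r)) (Ioc s t) ∧
        2 * ∫ r in Ioc s t, dissipation A a q (U r) ≤ ‖u s‖ ^ 2 - ‖u t‖ ^ 2 := by
  obtain ⟨hcont, -, U, G, hU, hUu, hG, huG, hweak⟩ := hu
  refine ⟨U, hUu, fun s t hs hst => ?_⟩
  obtain rfl | hlt := hst.eq_or_lt
  · simp
  have ht := hs.trans_lt hlt
  have hsub : Ioc s t ⊆ Ioc 0 t := Ioc_subset_Ioc_left hs
  have htested : ∀ T, 0 < T →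
      IntegrableOn (fun r => G r (U r) + dissipation A a q (U r)) (Ioc 0 T) ∧
        ∫ r in Ioc 0 T, (G r (U r) + dissipation A a q (U r)) = 0 := hweak U hU
  have hGU : IntegrableOn (fun r => G r (U r)) (Ioc s t) :=
    (integrable_pairing (hG t ht) (hU t ht)).mono_measure (Measure.restrict_mono hsub le_rfl)
  have hdiss : IntegrableOn (fun r => dissipation A a q (U r)) (Ioc s t) := by
    simpa only [Pi.sub_def, add_sub_cancel_left] using ((htested t ht).1.mono_set hsub).sub hGU
  have hbalance := setIntegral_Ioc_eq_zero htested hs hst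
  rw [integral_add hGU hdiss] at hbalance
  have henergy := energy_inequality hcont hU hG hUu
    (huG.inner_sub_inner_eq_integral (hcont.mono Ioi_subset_Ici_self) hG) hs hst
  exact ⟨hdiss, by linarith⟩

theorem IsWeakSolution.decaysAtRate (hq : -1 < q) (ha : ∀ᵐ x ∂volume.restrict Ω, 0 ≤ a x)
    (hav : ∀ v : W0 m Ω, IntegrableOn (fun x => a x * |W0.fn v x| ^ (1 + q)) Ω)
    (hC : 0 < C) (hcoer : IsCoercive Ω A C) (hu : IsWeakSolution A a q u₀ u) :
    DecaysAtRate (2 * min 1 C) (lambda1 m Ω a q) fun t => ‖u t‖ ^ 2 := by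
  have hq' : 1 + q ≠ 0 := by linarith
  obtain ⟨U, hUu, hdiss⟩ := hu.exists_dissipation_le
  have hdiss_nonneg : ∀ r, 0 ≤ dissipation A a q (U r) := fun r =>
    hcoer.dissipation_nonneg hq' ha hC (hav (U r))
  have hanti : ∀ s t, 0 ≤ s → s ≤ t → ‖u t‖ ^ 2 ≤ ‖u s‖ ^ 2 := fun s t hs hst => by
    linarith [(hdiss s t hs hst).2, setIntegral_nonneg (μ := volume)
      (measurableSet_Ioc (a := s) (b := t)) fun r _ => hdiss_nonneg r]
  intro s t hs hst
  obtain ⟨hint, hle⟩ := hdiss s t hs hst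
  have hrate : ∀ᵐ r ∂volume.restrict (Ioc s t), ENNReal.ofReal (min 1 C) *
      lambda1 m Ω a q (‖u t‖ ^ 2) ≤ ENNReal.ofReal (dissipation A a q (U r)) := by
    filter_upwards [ae_restrict_of_ae_restrict_of_subset (fun r hr => hs.trans_lt hr.1) hUu,
      ae_restrict_mem measurableSet_Ioc] with r hr hrI
    refine le_trans (mul_le_mul_right ?_ _)
      (hcoer.ofReal_mul_lambda1_le_dissipation hq' ha hC (hav (U r)))
    rw [hr]
    exact monotoneOn_lambda1 hq.le ha (sq_nonneg ‖u t‖) (sq_nonneg ‖u r‖)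
      (hanti r t (hs.trans hrI.1.le) hrI.2)
  calc ENNReal.ofReal (2 * min 1 C * (t - s)) * lambda1 m Ω a q (‖u t‖ ^ 2)
      = ENNReal.ofReal 2 *
          ∫⁻ _ in Ioc s t, ENNReal.ofReal (min 1 C) * lambda1 m Ω a q (‖u t‖ ^ 2) := by
        rw [setLIntegral_const, Real.volume_Ioc, ENNReal.ofReal_mul (by positivity),
          ENNReal.ofReal_mul zero_le_two]
        ring
    _ ≤ ENNReal.ofReal 2 * ∫⁻ r in Ioc s t, ENNReal.ofReal (dissipation A a q (U r)) :=
        mul_le_mul_right (lintegral_mono_ae hrate) _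
    _ = ENNReal.ofReal (2 * ∫ r in Ioc s t, dissipation A a q (U r)) := by
        rw [ENNReal.ofReal_mul zero_le_two, ofReal_integral_eq_lintegral_ofReal hint
          (Eventually.of_forall hdiss_nonneg)]
    _ ≤ ENNReal.ofReal (‖u s‖ ^ 2 - ‖u t‖ ^ 2) := ENNReal.ofReal_le_ofReal hle

theorem integrable_mul_abs_rpow {α : Type*} [MeasurableSpace α] {μ : Measure α}
    [IsFiniteMeasure μ] {b f : α → ℝ} {K r : ℝ} (hb : AEMeasurable b μ)
    (hbK : ∀ᵐ x ∂μ, |b x| ≤ K) (hf : MemLp f 2 μ) (hr₀ : 0 ≤ r) (hr₂ : r ≤ 2) :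
    Integrable (fun x => b x * |f x| ^ r) μ := by
  have hrpow : Integrable (fun x => |f x| ^ r) μ := by
    simpa only [ENNReal.toReal_ofReal hr₀, Real.norm_eq_abs] using
      (hf.mono_exponent (ENNReal.ofReal_le_ofNat.2 hr₂)).integrable_norm_rpow'
  exact hrpow.bdd_mul hb.aestronglyMeasurable hbK

end Solution

end Extinction

theorem proposition2p1_general {N m : ℕ} {Ω : Set (EuclideanSpace ℝ (Fin N))} {q : ℝ} (hq : -1 < q)
    {a : EuclideanSpace ℝ (Fin N) → ℝ} (ha : ∀ᵐ x ∂volume.restrict Ω, 0 ≤ a x)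
    (hav : ∀ v : Extinction.W0 m Ω,
      IntegrableOn (fun x => a x * |Extinction.W0.fn v x| ^ (1 + q)) Ω)
    {A : Extinction.Coeff N m} {C : ℝ} (hC : 0 < C) (hcoer : Extinction.IsCoercive Ω A C)
    (hint : (∫⁻ h in Ioc (0 : ℝ) 1, (Extinction.lambda1 m Ω a q h)⁻¹) < ⊤)
    {u₀ : Extinction.L2 Ω} {u : ℝ → Extinction.L2 Ω}
    (hu : Extinction.IsWeakSolution A a q u₀ u) :
    ∃ T : ℝ, Extinction.IsExtinctionTime u T ∧
      (∫⁻ h in Ioc (0 : ℝ) (‖u₀‖ ^ 2), (Extinction.lambda1 m Ω a q h)⁻¹) < ⊤ ∧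
      ENNReal.ofReal T ≤ ENNReal.ofReal (1 / (2 * min 1 C)) *
        ∫⁻ h in Ioc (0 : ℝ) (‖u₀‖ ^ 2), (Extinction.lambda1 m Ω a q h)⁻¹ := by
  have hmono : MonotoneOn (Extinction.lambda1 m Ω a q) (Ioi 0) :=
    (Extinction.monotoneOn_lambda1 hq.le ha).mono Ioi_subset_Ici_self
  have hcont : ContinuousOn (fun t => ‖u t‖ ^ 2) (Ici 0) := hu.1.norm.pow 2
  have hdecay := hu.decaysAtRate hq ha hav hC hcoer
  obtain ⟨T, hT, hTle⟩ := hdecay.exists_isLeast_forall_ge_eq_zero hmono hint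
    (mul_pos two_pos (lt_min one_pos hC)) hcont fun t _ => sq_nonneg ‖u t‖
  simp only [pow_eq_zero_iff two_ne_zero, norm_eq_zero] at hT
  rw [hu.2.1] at hTle
  exact ⟨T, hT, Extinction.lintegral_inv_lt_top hmono hint _, hTle⟩

theorem proposition2p1 (N m : ℕ) (hN : 1 ≤ N) (hm : 1 ≤ m)
    (Ω : Set (EuclideanSpace ℝ (Fin N))) (hΩo : IsOpen Ω) (hΩb : Bornology.IsBounded Ω)
    (q : ℝ) (hq0 : 0 < q) (hq1 : q < 1)
    (a : EuclideanSpace ℝ (Fin N) → ℝ) (ha_meas : AEMeasurable a (volume.restrict Ω))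
    (ha_nonneg : ∀ x ∈ Ω, 0 ≤ a x) (ha_bdd : ∃ K : ℝ, ∀ x ∈ Ω, a x ≤ K)
    (A : Extinction.Coeff N m) (hA : Extinction.IsCaratheodory Ω A)
    (hgrowth : Extinction.HasSublinearGrowth Ω A)
    (C : ℝ) (hC : 0 < C) (hcoer : Extinction.IsCoercive Ω A C)
    (hint : (∫⁻ h in Ioc (0 : ℝ) 1, (Extinction.lambda1 m Ω a q h)⁻¹) < ⊤)
    (u₀ : Extinction.L2 Ω) (u : ℝ → Extinction.L2 Ω)
    (hu : Extinction.IsWeakSolution A a q u₀ u) :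
    ∃ T : ℝ, Extinction.IsExtinctionTime u T ∧
      (∫⁻ h in Ioc (0 : ℝ) (‖u₀‖ ^ 2), (Extinction.lambda1 m Ω a q h)⁻¹) < ⊤ ∧
      ENNReal.ofReal T ≤ ENNReal.ofReal (1 / (2 * min 1 C)) *
        ∫⁻ h in Ioc (0 : ℝ) (‖u₀‖ ^ 2), (Extinction.lambda1 m Ω a q h)⁻¹ := by
  have : IsFiniteMeasure (volume.restrict Ω) :=
    isFiniteMeasure_restrict.2 hΩb.measure_lt_top.ne
  have ha : ∀ᵐ x ∂volume.restrict Ω, 0 ≤ a x :=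
    (ae_restrict_mem hΩo.measurableSet).mono ha_nonneg
  obtain ⟨K, haK⟩ := ha_bdd
  have haK' : ∀ᵐ x ∂volume.restrict Ω, |a x| ≤ K :=
    (ae_restrict_mem hΩo.measurableSet).mono fun x hx =>
      (abs_of_nonneg (ha_nonneg x hx)).trans_le (haK x hx)
  have hav : ∀ v : Extinction.W0 m Ω,
      IntegrableOn (fun x => a x * |Extinction.W0.fn v x| ^ (1 + q)) Ω := fun v =>
    Extinction.integrable_mul_abs_rpow ha_meas haK' (Lp.memLp _) (by linarith) (by linarith)
  exact proposition2p1_general (by linarith) ha hav hC hcoer hint hu
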